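/- Let $S$ be a separable real Hilbert space with dual $S^*$ and duality pairing $\langle y,x\rangle=y(x)$, and let $(E,\mathscr B,\mu)$ be a complete $\sigma$-finite measure space. A map $F:E\to 2^{S^*}$ with nonempty closed values is called $\mathscr B$-measurable if $\{u\in E: F(u)\cap O\neq\emptyset\}\in\mathscr B$ for every open $O\subset S^*$ (norm topology). Let $A:E\times S\to 2^{S^*}$ be a map with nonempty values such that 1. for every $x\in S$, the map $u\mapsto A(u,x)$ is $\mathscr B$-measurable; 2. for every $u\in E$, the map $x\mapsto A(u,x)$ is maximal monotone, i.e. $\langle y_1-y_2,x_1-x_2\rangle\ge 0$ whenever $y_i\in A(u,x_i)$, $i=1,2$, and the graph of $A(u,\cdot)$ is not properly contained in the graph of another monotone map $S\to 2^{S^*}$; 3. there are $C>0$ and $f\in L^2(E,\mathscr B,\mu)$, $f\ge 0$ $\mu$-a.e., such that for every $x\in S$, $$\sup_{y\in A(u,x)}\|y\|_{S^*}\le f(u)+C\|x\|_S\qquad\text{for $\mu$-a.e. }u\in E .$$ Define $\tilde A:L^2(E,\mathscr B,\mu;S)\to 2^{L^2(E,\mathscr B,\mu;S^*)}$ by $$\tilde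 A(x)=\{y\in L^2(E,\mathscr B,\mu;S^*) : y(u)\in A(u,x(u))\ \text{for $\mu$-a.e. }u\in E\}.$$ Then $\tilde A(x)\neq\emptyset$ for every $x\in L^2(E,\mathscr B,\mu;S)$, and $\tilde A$ is maximal monotone with respect to the duality pairing $\langle y,x\rangle=\int_E\langle y(u),x(u)\rangle\,d\mu(u)$ between $L^2(E,\mathscr B,\mu;S^*)$ and $L^2(E,\mathscr B,\mu;S)$. -/

import Mathlib

open MeasureTheory

/-- A set-valued map `A : X → 2^Y` is monotone with respect to a duality pairing
`b : Y × X → ℝ` if `⟨y₁ - y₂, x₁ - x₂⟩ ≥ 0` whenever `y₁ ∈ A x₁` and `y₂ ∈ A x₂`. -/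
def IsMonotoneMap {X Y : Type*} [Sub X] [Sub Y] (b : Y → X → ℝ) (A : X → Set Y) : Prop :=
  ∀ ⦃x₁ x₂ : X⦄ ⦃y₁ y₂ : Y⦄, y₁ ∈ A x₁ → y₂ ∈ A x₂ → 0 ≤ b (y₁ - y₂) (x₁ - x₂)

/-- `A` is maximal monotone: it is monotone, and every monotone map `A'` whose graph contains
the graph of `A` has the same graph as `A`. -/
def IsMaximalMonotone {X Y : Type*} [Sub X] [Sub Y] (b : Y → X → ℝ) (A : X → Set Y) : Prop :=
  IsMonotoneMap b A ∧
    ∀ A' : X → Set Y, IsMonotoneMap b A' → (∀ x, A x ⊆ A' x) → ∀ x, A' x = A x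

/-- The canonical pairing `⟨y, x⟩ = y x` between the dual `S*` and `S`. -/
def dualPairing {S : Type*} [NormedAddCommGroup S] [NormedSpace ℝ S]
    (y : StrongDual ℝ S) (x : S) : ℝ :=
  y x

/-- The duality pairing `⟨y, x⟩ = ∫ ⟨y(u), x(u)⟩ dμ(u)` between `L²(E; S*)` and `L²(E; S)`. -/
noncomputable def dualPairingL2 {E : Type*} [MeasurableSpace E] {μ : Measure E}
    {S : Type*} [NormedAddCommGroup S] [NormedSpace ℝ S]
    (y : Lp (StrongDual ℝ S) 2 μ) (x : Lp S 2 μ) : ℝ :=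
  ∫ u, dualPairing (y u) (x u) ∂μ

/-- The integrand of the `L²` pairing is always integrable. -/
theorem integrable_dualPairing {E : Type*} [MeasurableSpace E] {μ : Measure E}
    {S : Type*} [NormedAddCommGroup S] [NormedSpace ℝ S]
    (y : Lp (StrongDual ℝ S) 2 μ) (x : Lp S 2 μ) :
    Integrable (fun u => dualPairing (y u) (x u)) μ := by
  have h := (ContinuousLinearMap.id ℝ (StrongDual ℝ S)).memLp_of_bilin
    1 (Lp.memLp y) (Lp.memLp x)
  exact memLp_one_iff_integrable.mp h

/-- A set-valued map `F : E → 2^Y` is measurable if `{u | F(u) ∩ O ≠ ∅}` is measurable for every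
open set `O ⊆ Y`. -/
def IsMeasurableMultimap {E Y : Type*} [MeasurableSpace E] [TopologicalSpace Y]
    (F : E → Set Y) : Prop :=
  ∀ O : Set Y, IsOpen O → MeasurableSet {u : E | (F u ∩ O).Nonempty}

/-- The Nemytskii lift of `A : E × S → 2^{S*}`: the map sending `x ∈ L²(E; S)` to the set of all
`y ∈ L²(E; S*)` with `y(u) ∈ A(u, x(u))` for `μ`-a.e. `u`. -/
def nemytskiiLift {E : Type*} [MeasurableSpace E] (μ : Measure E)
    {S : Type*} [NormedAddCommGroup S] [NormedSpace ℝ S]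
    (A : E → S → Set (StrongDual ℝ S)) (x : Lp S 2 μ) : Set (Lp (StrongDual ℝ S) 2 μ) :=
  {y | ∀ᵐ u ∂μ, y u ∈ A u (x u)}

open Filter Topology Set

/-! Each `A(·, z)` has a measurable selection `s z`. Composing `s` with a simple function gives an
element of the lift's graph, with the `L²` bound coming from the growth condition. Suppose `(x, y)`
is monotonically related to the graph of the lift. Testing it against functions equal to `z` on a
set `B` and close to `x` off `B` localizes the inequality: `⟨s z - y, z - x⟩ ≥ 0` a.e., for each
`z`. Countably many dense `z` suffice to put `y(u)` in `A(u, x(u))`, by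
`IsMaximalMonotone.mem_of_denseRange`. This is maximality. It also gives nonempty values: if simple
functions tend to `x`, a weak limit of their selections is monotonically related to the graph at
`x`. -/

/-- **Kuratowski–Ryll-Nardzewski**: a measurable multimap with nonempty closed values in a
separable complete metric space has a strongly measurable selection. -/
theorem IsMeasurableMultimap.exists_stronglyMeasurable_selection {E Y : Type*} [MeasurableSpace E]
    [MetricSpace Y] [CompleteSpace Y] [TopologicalSpace.SeparableSpace Y] {F : E → Set Y}
    (hF : IsMeasurableMultimap F) (hne : ∀ u, (F u).Nonempty) (hcl : ∀ u, IsClosed (F u)) :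
    ∃ s : E → Y, StronglyMeasurable s ∧ ∀ u, s u ∈ F u := by
  classical
  rcases isEmpty_or_nonempty E with hE | ⟨⟨u₀⟩⟩
  · exact ⟨isEmptyElim, .of_subsingleton_dom, isEmptyElim⟩
  have : Nonempty Y := (hne u₀).to_type
  obtain ⟨q, hq⟩ := TopologicalSpace.exists_dense_seq Y
  let r : ℕ → ℝ := fun n => (1 / 2) ^ n
  have hr : ∀ n, 0 < r n := fun n => by positivity
  have hrs : ∀ n, r (n + 1) = r n / 2 := fun n => by simp only [r, pow_succ]; ring
  have start : ∃ k : E → ℕ, Measurable k ∧ ∀ u, (F u ∩ Metric.ball (q (k u)) (r 0)).Nonempty := by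
    have hp : ∀ u, ∃ k, (F u ∩ Metric.ball (q k) (r 0)).Nonempty := fun u => by
      obtain ⟨y, hy⟩ := hne u
      obtain ⟨k, hk⟩ := hq.exists_dist_lt y (hr 0)
      exact ⟨k, y, hy, hk⟩
    exact ⟨fun u => Nat.find (hp u), measurable_find hp fun k => hF _ Metric.isOpen_ball,
      fun u => Nat.find_spec (hp u)⟩
  have step : ∀ (n : ℕ) (k : E → ℕ), Measurable k →
      (∀ u, (F u ∩ Metric.ball (q (k u)) (r n)).Nonempty) →
      ∃ l : E → ℕ, Measurable l ∧ (∀ u, (F u ∩ Metric.ball (q (l u)) (r (n + 1))).Nonempty) ∧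
        ∀ u, dist (q (k u)) (q (l u)) < 2 * r n := by
    intro n k hk hkF
    -- Both centres are near one point of `F u`, so they differ by less than `r n + r (n + 1) < 2 *
    -- r n`, which is summable. Taking the least such index keeps the choice measurable.
    have hp : ∀ u, ∃ l, (F u ∩ Metric.ball (q l) (r (n + 1))).Nonempty ∧
        dist (q (k u)) (q l) < 2 * r n := fun u => by
      obtain ⟨y, hy, hyk⟩ := hkF u
      obtain ⟨l, hl⟩ := hq.exists_dist_lt y (hr (n + 1))
      refine ⟨l, ⟨y, hy, hl⟩, ?_⟩
      have := dist_triangle_left (q (k u)) (q l) y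
      have h1 := hrs n
      have h2 := hr n
      rw [Metric.mem_ball] at hyk
      linarith
    refine ⟨fun u => Nat.find (hp u), measurable_find hp fun l => ?_,
      fun u => (Nat.find_spec (hp u)).1, fun u => (Nat.find_spec (hp u)).2⟩
    exact (hF _ Metric.isOpen_ball).inter
      (hk (MeasurableSet.of_discrete (s := {j | dist (q j) (q l) < 2 * r n})))
  choose! next hnm hnF hnd using step
  obtain ⟨k₀, hk₀m, hk₀F⟩ := start
  let k : ℕ → E → ℕ := fun n => Nat.rec k₀ (fun n k => next n k) n
  have hk : ∀ n, Measurable (k n) ∧ ∀ u, (F u ∩ Metric.ball (q (k n u)) (r n)).Nonempty := by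
    intro n
    induction n with
    | zero => exact ⟨hk₀m, hk₀F⟩
    | succ n ih => exact ⟨hnm n _ ih.1 ih.2, hnF n _ ih.1 ih.2⟩
  have hd : ∀ u n, dist (q (k n u)) (q (k (n + 1) u)) ≤ 2 * (1 / 2 : ℝ) ^ n :=
    fun u n => (hnd n _ (hk n).1 (hk n).2 u).le
  have hlim : ∀ u, ∃ y, Tendsto (fun n => q (k n u)) atTop (𝓝 y) := fun u =>
    cauchySeq_tendsto_of_complete (cauchySeq_of_le_geometric _ _ (by norm_num) (hd u))
  choose s hs using hlim
  refine ⟨s, stronglyMeasurable_of_tendsto atTop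
    (fun n => (StronglyMeasurable.of_discrete (f := q)).comp_measurable (hk n).1)
    (tendsto_pi_nhds.2 hs), fun u => ?_⟩
  choose y hyF hyb using fun n => (hk n).2 u
  have hr0 : Tendsto r atTop (𝓝 0) :=
    tendsto_pow_atTop_nhds_zero_of_lt_one (by norm_num) (by norm_num)
  refine (hcl u).mem_of_tendsto (b := atTop) (f := y) ?_ (Eventually.of_forall hyF)
  refine (tendsto_iff_of_dist (squeeze_zero (fun _ => dist_nonneg)
    (fun n => ?_) hr0)).1 (hs u)
  rw [dist_comm]
  exact (hyb n).le

/-! ### Maximal monotone maps at a fixed point of `E`. -/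

section Pointwise

variable {S : Type*} [NormedAddCommGroup S] [NormedSpace ℝ S] {T : S → Set (StrongDual ℝ S)}

theorem IsMaximalMonotone.mem_of_forall (hT : IsMaximalMonotone dualPairing T) {x : S}
    {y : StrongDual ℝ S} (h : ∀ z, ∀ v ∈ T z, 0 ≤ (v - y) (z - x)) : y ∈ T x := by
  -- Adjoining the single pair `(x, y)` to the graph keeps it monotone.
  have key := hT.2 (fun z => T z ∪ {v | z = x ∧ v = y}) ?_ (fun z => subset_union_left) x
  · rw [← key]
    exact Or.inr ⟨rfl, rfl⟩
  · rintro z₁ z₂ v₁ v₂ (h₁ | ⟨rfl, rfl⟩) (h₂ | ⟨rfl, rfl⟩)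
    · exact hT.1 h₁ h₂
    · exact h _ _ h₁
    · have := h _ _ h₂
      simp only [dualPairing, map_sub, sub_apply] at this ⊢
      linarith
    · simp [dualPairing]

theorem IsMaximalMonotone.isClosed (hT : IsMaximalMonotone dualPairing T) (x : S) :
    IsClosed (T x) := by
  have : T x = ⋂ (z) (v ∈ T z), {y : StrongDual ℝ S | 0 ≤ (v - y) (z - x)} := by
    ext y
    simp only [mem_iInter, mem_ofPred_eq]
    exact ⟨fun hy z v hv => hT.1 hv hy, hT.mem_of_forall⟩
  rw [this]
  refine isClosed_iInter fun z => isClosed_biInter fun v _ => isClosed_le continuous_const ?_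
  exact (ContinuousLinearMap.apply ℝ ℝ (z - x)).continuous.comp (continuous_const.sub continuous_id)

/-- For a maximal monotone map, membership in the graph can be tested against one value at each
point of a dense sequence, as long as these values are bounded on bounded sets. -/
theorem IsMaximalMonotone.mem_of_denseRange (hT : IsMaximalMonotone dualPairing T)
    {p : ℕ → S} (hp : DenseRange p) {w : ℕ → StrongDual ℝ S} (hw : ∀ n, w n ∈ T (p n))
    {a C : ℝ} (hb : ∀ n, ‖w n‖ ≤ a + C * ‖p n‖) {x : S} {y : StrongDual ℝ S}
    (h : ∀ n, 0 ≤ (w n - y) (p n - x)) : y ∈ T x := by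
  refine hT.mem_of_forall fun z v hv => ?_
  -- At the midpoint, `m - x = z - m = (z - x) / 2`, so the unknown value `w` cancels when the two
  -- inequalities are added. Off the midpoint the error is controlled by the bound on `w`.
  set m : S := (1 / 2 : ℝ) • (x + z) with hm
  obtain ⟨b, hbr, hbm⟩ := mem_closure_iff_seq_limit.1 (hp m)
  choose φ hφ using hbr
  obtain rfl : (fun k => p (φ k)) = b := funext hφ
  have hlow : ∀ k, -((2 * (a + C * ‖p (φ k)‖) + ‖y‖ + ‖v‖) * ‖p (φ k) - m‖) ≤
      (v - y) (z - x) / 2 := fun k => by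
    have h₁ := h (φ k)
    have h₂ : 0 ≤ (v - w (φ k)) (z - p (φ k)) := hT.1 hv (hw _)
    have h₃ : (w (φ k) - y) (p (φ k) - x) + (v - w (φ k)) (z - p (φ k)) =
        (v - y) (z - x) / 2 + ((2 : ℝ) • w (φ k) - y - v) (p (φ k) - m) := by
      simp only [hm, map_sub, map_add, map_smul, sub_apply,
        smul_apply, smul_eq_mul]
      ring
    have h₄ := (le_abs_self _).trans
      (((2 : ℝ) • w (φ k) - y - v).le_opNorm (p (φ k) - m))
    have h₅ : ‖(2 : ℝ) • w (φ k) - y - v‖ ≤ 2 * (a + C * ‖p (φ k)‖) + ‖y‖ + ‖v‖ := by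
      refine (norm_sub_le _ _).trans (add_le_add_left ((norm_sub_le _ _).trans
        (add_le_add_left ?_ _)) _)
      rw [norm_smul, Real.norm_two]
      linarith [hb (φ k)]
    have h₆ := mul_le_mul_of_nonneg_right h₅ (norm_nonneg (p (φ k) - m))
    linarith
  have hlim : Tendsto (fun k => -((2 * (a + C * ‖p (φ k)‖) + ‖y‖ + ‖v‖) * ‖p (φ k) - m‖)) atTop
      (𝓝 (-((2 * (a + C * ‖m‖) + ‖y‖ + ‖v‖) * ‖m - m‖))) :=
    ((((((hbm.norm.const_mul C).const_add a).const_mul 2).add_const _).add_const _).mul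
      (hbm.sub_const m).norm).neg
  have := le_of_tendsto' hlim hlow
  simp only [sub_self, norm_zero, mul_zero, neg_zero] at this
  linarith

end Pointwise

/-! ### The `L²` duality and weak compactness. -/

section Pairing

variable {E : Type*} [MeasurableSpace E] {μ : Measure E}

/-- The duality pairing between `L²(E; S*)` and `L²(E; S)` as a continuous bilinear map. -/
noncomputable def dualPairingL2CLM {S : Type*} [NormedAddCommGroup S] [NormedSpace ℝ S]
    (μ : Measure E) : Lp (StrongDual ℝ S) 2 μ →L[ℝ] Lp S 2 μ →L[ℝ] ℝ :=
  (ContinuousLinearMap.id ℝ (StrongDual ℝ S)).lpPairing μ 2 2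

theorem dualPairingL2CLM_apply {S : Type*} [NormedAddCommGroup S] [NormedSpace ℝ S]
    (y : Lp (StrongDual ℝ S) 2 μ) (x : Lp S 2 μ) :
    dualPairingL2CLM μ y x = dualPairingL2 y x :=
  ContinuousLinearMap.lpPairing_eq_integral _ _ _

theorem integral_abs_dualPairing_le {S : Type*} [NormedAddCommGroup S] [NormedSpace ℝ S]
    (y : Lp (StrongDual ℝ S) 2 μ) (x : Lp S 2 μ) :
    ∫ u, |dualPairing (y u) (x u)| ∂μ ≤ ‖y‖ * ‖x‖ := by
  have hy := (Lp.memLp y).norm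
  have hx := (Lp.memLp x).norm
  have hyn : ‖hy.toLp _‖ = ‖y‖ := by rw [Lp.norm_toLp, eLpNorm_norm, Lp.norm_def]
  have hxn : ‖hx.toLp _‖ = ‖x‖ := by rw [Lp.norm_toLp, eLpNorm_norm, Lp.norm_def]
  have key := real_inner_le_norm (hy.toLp _) (hx.toLp _)
  rw [hyn, hxn] at key
  refine le_trans ?_ key
  rw [L2.inner_def]
  refine integral_mono_ae (integrable_dualPairing y x).abs (L2.integrable_inner _ _) ?_
  filter_upwards [hy.coeFn_toLp, hx.coeFn_toLp] with u h₁ h₂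
  rw [h₁, h₂, RCLike.inner_apply, conj_trivial, mul_comm]
  exact (y u).le_opNorm (x u)

theorem abs_dualPairingL2_le {S : Type*} [NormedAddCommGroup S] [NormedSpace ℝ S]
    (y : Lp (StrongDual ℝ S) 2 μ) (x : Lp S 2 μ) : |dualPairingL2 y x| ≤ ‖y‖ * ‖x‖ :=
  abs_integral_le_integral_abs.trans (integral_abs_dualPairing_le y x)

variable {S : Type*} [NormedAddCommGroup S] [InnerProductSpace ℝ S] [CompleteSpace S]

/-- Every continuous linear functional on `L²(E; S)` is represented by an element of
`L²(E; S*)`. -/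
theorem exists_dualPairingL2CLM_eq (l : StrongDual ℝ (Lp S 2 μ)) :
    ∃ y : Lp (StrongDual ℝ S) 2 μ, dualPairingL2CLM μ y = l := by
  set v : Lp S 2 μ := (InnerProductSpace.toDual ℝ (Lp S 2 μ)).symm l with hv
  have hmem : MemLp (fun u => InnerProductSpace.toDual ℝ S (v u)) 2 μ :=
    (Lp.memLp v).of_le
      ((InnerProductSpace.toDual ℝ S).continuous.comp_aestronglyMeasurable
        (Lp.aestronglyMeasurable v))
      (Eventually.of_forall fun u => by simp)
  refine ⟨hmem.toLp _, ContinuousLinearMap.ext fun x => ?_⟩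
  have hl : l x = inner ℝ v x := by
    rw [hv, InnerProductSpace.toDual_symm_apply]
  rw [dualPairingL2CLM_apply, hl, L2.inner_def]
  refine integral_congr_ae ?_
  filter_upwards [hmem.coeFn_toLp] with u hu
  rw [dualPairing, hu, InnerProductSpace.toDual_apply_apply]

/-- Bounded sequences in `L²(E; S*)` converge weakly along an ultrafilter. -/
theorem exists_tendsto_dualPairingL2CLM {y : ℕ → Lp (StrongDual ℝ S) 2 μ} {R : ℝ}
    (hy : ∀ k, ‖y k‖ ≤ R) :
    ∃ y₀ : Lp (StrongDual ℝ S) 2 μ, ∀ x, Tendsto (fun k => dualPairingL2CLM μ (y k) x)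
      (hyperfilter ℕ) (𝓝 (dualPairingL2CLM μ y₀ x)) := by
  set P := dualPairingL2CLM (S := S) μ
  -- Banach–Alaoglu; the ultrafilter replaces extraction of a subsequence.
  have hc := WeakDual.isCompact_closedBall (𝕜 := ℝ) (E := Lp S 2 μ) 0 R
  obtain ⟨l, -, hl⟩ := hc.ultrafilter_le_nhds
    ((hyperfilter ℕ).map fun k => StrongDual.toWeakDual (P (y k))) (by
      refine tendsto_principal.2 (Eventually.of_forall fun k => ?_)
      refine mem_closedBall_zero_iff.2 (le_trans ?_ (hy k))
      refine ContinuousLinearMap.opNorm_le_bound (P (y k)) (norm_nonneg _) fun x => ?_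
      rw [dualPairingL2CLM_apply]
      exact abs_dualPairingL2_le _ _)
  obtain ⟨y₀, hy₀⟩ := exists_dualPairingL2CLM_eq (WeakDual.toStrongDual l)
  refine ⟨y₀, fun x => ?_⟩
  rw [hy₀]
  exact ((WeakDual.eval_continuous x).tendsto l).comp hl

end Pairing

theorem isMonotoneMap_nemytskiiLift {E : Type*} [MeasurableSpace E] {μ : Measure E} {S : Type*}
    [NormedAddCommGroup S] [NormedSpace ℝ S] {A : E → S → Set (StrongDual ℝ S)}
    (hA : ∀ u, IsMonotoneMap dualPairing (A u)) :
    IsMonotoneMap dualPairingL2 (nemytskiiLift μ A) := by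
  intro x₁ x₂ y₁ y₂ h₁ h₂
  refine integral_nonneg_of_ae ?_
  filter_upwards [h₁, h₂, Lp.coeFn_sub y₁ y₂, Lp.coeFn_sub x₁ x₂] with u h₁ h₂ hy hx
  rw [hy, hx]
  exact hA u h₁ h₂

/-! ### Localization of monotonicity and the lifted map. -/

section Lift

variable {E : Type*} [MeasurableSpace E] {μ : Measure E}
  {S : Type*} [NormedAddCommGroup S] [InnerProductSpace ℝ S]
  {A : E → S → Set (StrongDual ℝ S)}

theorem exists_stronglyMeasurable_selection_apply [CompleteSpace S]
    [TopologicalSpace.SeparableSpace S] (hA_nonempty : ∀ u x, (A u x).Nonempty)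
    (hA_meas : ∀ x : S, IsMeasurableMultimap (fun u => A u x))
    (hA_maxmon : ∀ u : E, IsMaximalMonotone dualPairing (A u)) (z : S) :
    ∃ s : E → StrongDual ℝ S, StronglyMeasurable s ∧ ∀ u, s u ∈ A u z := by
  have : TopologicalSpace.SeparableSpace (StrongDual ℝ S) :=
    (InnerProductSpace.toDual ℝ S).surjective.denseRange.separableSpace
      (InnerProductSpace.toDual ℝ S).continuous
  exact (hA_meas z).exists_stronglyMeasurable_selection (fun u => hA_nonempty u z)
    fun u => (hA_maxmon u).isClosed z

variable {f : E → ℝ} {C : ℝ} {s : S → E → StrongDual ℝ S}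

/-- No joint measurability of `s` is known, and the exceptional null set of the growth bound depends
on `z`. Finite range resolves both. -/
theorem SimpleFunc.memLp_selection_apply (hf : MemLp f 2 μ)
    (hA_growth : ∀ x : S, ∀ᵐ u ∂μ, ∀ y ∈ A u x, ‖y‖ ≤ f u + C * ‖x‖)
    (hs : ∀ z, StronglyMeasurable (s z)) (hsA : ∀ z u, s z u ∈ A u z)
    (φ : SimpleFunc E S) (hφ : MemLp φ 2 μ) :
    MemLp (fun u => s (φ u) u) 2 μ ∧ ∀ᵐ u ∂μ, ‖s (φ u) u‖ ≤ f u + C * ‖φ u‖ := by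
  have hb : ∀ᵐ u ∂μ, ‖s (φ u) u‖ ≤ f u + C * ‖φ u‖ := by
    have : ∀ᵐ u ∂μ, ∀ z ∈ φ.range, ∀ y ∈ A u z, ‖y‖ ≤ f u + C * ‖z‖ :=
      (ae_ball_iff φ.range.countable_toSet).2 fun z _ => hA_growth z
    filter_upwards [this] with u hu
    exact hu _ (φ.mem_range_self u) _ (hsA _ _)
  have hm : AEStronglyMeasurable (fun u => s (φ u) u) μ := by
    have : (fun u => s (φ u) u) = fun u => ∑ z ∈ φ.range, (φ ⁻¹' {z}).indicator (s z) u := by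
      classical
      funext u
      rw [Finset.sum_eq_single (φ u)]
      · simp
      · intro z _ hz
        exact indicator_of_notMem (fun h => hz h.symm) _
      · exact fun h => absurd (φ.mem_range_self u) h
    rw [this]
    exact (Finset.stronglyMeasurable_fun_sum _ fun z _ =>
      (hs z).indicator (φ.measurableSet_fiber z)).aestronglyMeasurable
  refine ⟨(hf.add (hφ.norm.const_mul C)).of_le hm ?_, hb⟩
  filter_upwards [hb] with u hu
  exact hu.trans (le_abs_self _)

/-- Every `x ∈ L²(E; S)` is the limit of simple functions along which `s` is bounded in `L²`. -/
theorem exists_simpleFunc_tendsto (hf : MemLp f 2 μ)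
    (hA_growth : ∀ x : S, ∀ᵐ u ∂μ, ∀ y ∈ A u x, ‖y‖ ≤ f u + C * ‖x‖) (hC : 0 ≤ C)
    (hs : ∀ z, StronglyMeasurable (s z)) (hsA : ∀ z u, s z u ∈ A u z) (x : Lp S 2 μ) :
    ∃ (φ : ℕ → SimpleFunc E S) (hφ : ∀ k, MemLp (φ k) 2 μ)
      (hy : ∀ k, MemLp (fun u => s (φ k u) u) 2 μ) (R : ℝ),
      Tendsto (fun k => (hφ k).toLp (φ k)) atTop (𝓝 x) ∧ ∀ k, ‖(hy k).toLp _‖ ≤ R := by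
  obtain ⟨b, hb, hbx⟩ := mem_closure_iff_seq_limit.1
    (Lp.simpleFunc.denseRange (E := S) (μ := μ) (p := 2) (by simp) x)
  choose g hg using hb
  obtain rfl : (fun k => (g k : Lp S 2 μ)) = b := funext hg
  have hφ := fun k => Lp.simpleFunc.memLp (g k)
  have key := fun k =>
    SimpleFunc.memLp_selection_apply hf hA_growth hs hsA (Lp.simpleFunc.toSimpleFunc (g k)) (hφ k)
  have hgk : ∀ k, (hφ k).toLp _ = (g k : Lp S 2 μ) := fun k =>
    congrArg Subtype.val (Lp.simpleFunc.toLp_toSimpleFunc (g k))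
  obtain ⟨K, hK⟩ := hbx.norm.bddAbove_range
  refine ⟨_, hφ, fun k => (key k).1, ‖hf.toLp f‖ + C * K, ?_, fun k => ?_⟩
  · simpa only [hgk] using hbx
  · have hn : MemLp (fun u => ‖Lp.simpleFunc.toSimpleFunc (g k) u‖) 2 μ := (hφ k).norm
    have h₁ : ‖(key k).1.toLp _‖ ≤ ‖hf.toLp f + C • hn.toLp _‖ := by
      refine Lp.norm_le_norm_of_ae_le ?_
      filter_upwards [(key k).1.coeFn_toLp, (key k).2, Lp.coeFn_add (hf.toLp f) (C • hn.toLp _),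
        Lp.coeFn_smul C (hn.toLp _), hf.coeFn_toLp, hn.coeFn_toLp] with u h₁ h₂ h₃ h₄ h₅ h₆
      rw [h₁, h₃, Pi.add_apply, h₄, Pi.smul_apply, h₅, h₆]
      exact h₂.trans (le_abs_self _)
    have h₂ : ‖hn.toLp _‖ = ‖(g k : Lp S 2 μ)‖ := by
      rw [← hgk k, Lp.norm_toLp, Lp.norm_toLp, eLpNorm_norm]
    refine h₁.trans ((norm_add_le _ _).trans ?_)
    rw [norm_smul, Real.norm_of_nonneg hC, h₂]
    gcongr
    exact hK ⟨k, rfl⟩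

/-- A pair that is monotonically related to the graph of the lift satisfies the pointwise
monotonicity inequality against `(z, s z)`. -/
theorem ae_nonneg_of_forall_dualPairingL2_nonneg [SigmaFinite μ] (hf : MemLp f 2 μ)
    (hA_growth : ∀ x : S, ∀ᵐ u ∂μ, ∀ y ∈ A u x, ‖y‖ ≤ f u + C * ‖x‖) (hC : 0 ≤ C)
    (hs : ∀ z, StronglyMeasurable (s z)) (hsA : ∀ z u, s z u ∈ A u z)
    {x : Lp S 2 μ} {y : Lp (StrongDual ℝ S) 2 μ}
    (h : ∀ x' : Lp S 2 μ, ∀ y' ∈ nemytskiiLift μ A x', 0 ≤ dualPairingL2 (y' - y) (x' - x))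
    (z : S) : ∀ᵐ u ∂μ, 0 ≤ (s z u - y u) (z - x u) := by
  classical
  obtain ⟨φ, hφ, hw, R, hlim, hR⟩ := exists_simpleFunc_tendsto hf hA_growth hC hs hsA x
  have hint : ∀ B, MeasurableSet B → μ B < ⊤ →
      IntegrableOn (fun u => (s z u - y u) (z - x u)) B μ := fun B hB hμB => by
    have : IsFiniteMeasure (μ.restrict B) := ⟨by simpa using hμB⟩
    have hsz : MemLp (s z) 2 (μ.restrict B) := by
      refine (hf.restrict B |>.add (memLp_const (C * ‖z‖))).of_le (hs z).aestronglyMeasurable ?_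
      filter_upwards [ae_restrict_of_ae (hA_growth z)] with u hu
      exact (hu _ (hsA z u)).trans (le_abs_self _)
    exact memLp_one_iff_integrable.1
      ((ContinuousLinearMap.id ℝ (StrongDual ℝ S)).memLp_of_bilin 1
        (hsz.sub ((Lp.memLp y).restrict B)) ((memLp_const z).sub ((Lp.memLp x).restrict B)))
  refine ae_nonneg_of_forall_setIntegral_nonneg_of_sigmaFinite hint fun B hB hμB => ?_
  have hlow : ∀ k, -((R + ‖y‖) * ‖(hφ k).toLp (φ k) - x‖) ≤
      ∫ u in B, (s z u - y u) (z - x u) ∂μ := fun k => by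
    -- The test function is `z` on `B` and `φ k` elsewhere. Off `B` its contribution is at most `(R
    -- + ‖y‖) * ‖φ k - x‖`, which vanishes in the limit.
    have hψ : MemLp ((SimpleFunc.const E z).piecewise B hB (φ k)) 2 μ := by
      have : IsFiniteMeasure (μ.restrict B) := ⟨by simpa using hμB⟩
      rw [SimpleFunc.coe_piecewise]
      exact MemLp.piecewise hB (memLp_const z) ((hφ k).restrict _)
    set ψ := (SimpleFunc.const E z).piecewise B hB (φ k) with hψ_def
    have hv := (SimpleFunc.memLp_selection_apply hf hA_growth hs hsA ψ hψ).1
    have hmem : hv.toLp _ ∈ nemytskiiLift μ A (hψ.toLp ψ) := by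
      filter_upwards [hv.coeFn_toLp, hψ.coeFn_toLp] with u h₁ h₂
      rw [h₁, h₂]
      exact hsA _ _
    have h0 := h _ _ hmem
    rw [dualPairingL2, ← integral_add_compl hB (integrable_dualPairing _ _)] at h0
    have hψu : ∀ u, ψ u = if u ∈ B then z else φ k u := fun u => rfl
    have hcoe : ∀ᵐ u ∂μ, dualPairing ((hv.toLp _ - y : Lp (StrongDual ℝ S) 2 μ) u)
        ((hψ.toLp ψ - x : Lp S 2 μ) u) = (s (ψ u) u - y u) (ψ u - x u) := by
      filter_upwards [hv.coeFn_toLp, hψ.coeFn_toLp, Lp.coeFn_sub (hv.toLp _) y,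
        Lp.coeFn_sub (hψ.toLp ψ) x] with u h₁ h₂ h₃ h₄
      rw [h₃, h₄, Pi.sub_apply, Pi.sub_apply, h₁, h₂, dualPairing]
    have hin : ∫ u in B, dualPairing ((hv.toLp _ - y : Lp (StrongDual ℝ S) 2 μ) u)
        ((hψ.toLp ψ - x : Lp S 2 μ) u) ∂μ = ∫ u in B, (s z u - y u) (z - x u) ∂μ := by
      refine setIntegral_congr_ae hB ?_
      filter_upwards [hcoe] with u hu huB
      rw [hu, hψu, if_pos huB]
    have hout : ∫ u in Bᶜ, dualPairing ((hv.toLp _ - y : Lp (StrongDual ℝ S) 2 μ) u)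
        ((hψ.toLp ψ - x : Lp S 2 μ) u) ∂μ ≤
        ‖(hw k).toLp _ - y‖ * ‖(hφ k).toLp (φ k) - x‖ := by
      refine le_trans ?_ (integral_abs_dualPairing_le _ _)
      refine le_trans ?_ (setIntegral_le_integral (s := Bᶜ) (integrable_dualPairing _ _).abs
        (Eventually.of_forall fun _ => abs_nonneg _))
      refine setIntegral_mono_on_ae (integrable_dualPairing _ _).integrableOn
        (integrable_dualPairing _ _).abs.integrableOn hB.compl ?_
      filter_upwards [hcoe, (hw k).coeFn_toLp, (hφ k).coeFn_toLp, Lp.coeFn_sub ((hw k).toLp _) y,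
        Lp.coeFn_sub ((hφ k).toLp (φ k)) x] with u hu h₁ h₂ h₃ h₄ huB
      rw [hu, hψu, if_neg huB, h₃, h₄, Pi.sub_apply, Pi.sub_apply, h₁, h₂]
      exact le_abs_self _
    have hR' : ‖(hw k).toLp _ - y‖ * ‖(hφ k).toLp (φ k) - x‖ ≤
        (R + ‖y‖) * ‖(hφ k).toLp (φ k) - x‖ :=
      mul_le_mul_of_nonneg_right ((norm_sub_le _ _).trans (by gcongr; exact hR k)) (norm_nonneg _)
    linarith
  have hzero : Tendsto (fun k => -((R + ‖y‖) * ‖(hφ k).toLp (φ k) - x‖)) atTop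
      (𝓝 (-((R + ‖y‖) * ‖x - x‖))) := ((hlim.sub_const x).norm.const_mul _).neg
  simpa using le_of_tendsto' hzero hlow

theorem mem_nemytskiiLift_of_forall
    [TopologicalSpace.SeparableSpace S] [SigmaFinite μ] (hf : MemLp f 2 μ)
    (hA_maxmon : ∀ u : E, IsMaximalMonotone dualPairing (A u))
    (hA_growth : ∀ x : S, ∀ᵐ u ∂μ, ∀ y ∈ A u x, ‖y‖ ≤ f u + C * ‖x‖) (hC : 0 ≤ C)
    (hs : ∀ z, StronglyMeasurable (s z)) (hsA : ∀ z u, s z u ∈ A u z)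
    {x : Lp S 2 μ} {y : Lp (StrongDual ℝ S) 2 μ}
    (h : ∀ x' : Lp S 2 μ, ∀ y' ∈ nemytskiiLift μ A x', 0 ≤ dualPairingL2 (y' - y) (x' - x)) :
    y ∈ nemytskiiLift μ A x := by
  obtain ⟨p, hp⟩ := TopologicalSpace.exists_dense_seq S
  filter_upwards [ae_all_iff.2 fun n => hA_growth (p n), ae_all_iff.2 fun n =>
    ae_nonneg_of_forall_dualPairingL2_nonneg hf hA_growth hC hs hsA h (p n)] with u hg hu
  exact (hA_maxmon u).mem_of_denseRange hp (w := fun n => s (p n) u) (fun n => hsA _ _)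
    (fun n => hg n _ (hsA _ _)) hu

theorem nemytskiiLift_nonempty [CompleteSpace S]
    [TopologicalSpace.SeparableSpace S] [SigmaFinite μ] (hf : MemLp f 2 μ)
    (hA_maxmon : ∀ u : E, IsMaximalMonotone dualPairing (A u))
    (hA_growth : ∀ x : S, ∀ᵐ u ∂μ, ∀ y ∈ A u x, ‖y‖ ≤ f u + C * ‖x‖) (hC : 0 ≤ C)
    (hs : ∀ z, StronglyMeasurable (s z)) (hsA : ∀ z u, s z u ∈ A u z) (x : Lp S 2 μ) :
    (nemytskiiLift μ A x).Nonempty := by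
  obtain ⟨φ, hφ, hw, R, hlim, hR⟩ := exists_simpleFunc_tendsto hf hA_growth hC hs hsA x
  obtain ⟨y, hy⟩ := exists_tendsto_dualPairingL2CLM hR
  refine ⟨y, mem_nemytskiiLift_of_forall hf hA_maxmon hA_growth hC hs hsA fun x' y' hy' => ?_⟩
  have hmem : ∀ k, (hw k).toLp _ ∈ nemytskiiLift μ A ((hφ k).toLp (φ k)) := fun k => by
    filter_upwards [(hw k).coeFn_toLp, (hφ k).coeFn_toLp] with u h₁ h₂
    rw [h₁, h₂]
    exact hsA _ _
  -- Monotonicity holds at `φ k`; replacing `φ k` by `x` costs a term that vanishes by strong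
  -- convergence, leaving an expression continuous under weak convergence.
  have hlow : ∀ k, -((‖y'‖ + R) * ‖x - (hφ k).toLp (φ k)‖) ≤
      dualPairingL2CLM μ y' (x' - x) - dualPairingL2CLM μ ((hw k).toLp _) (x' - x) := fun k => by
    have h₁ := isMonotoneMap_nemytskiiLift (fun u => (hA_maxmon u).1) hy' (hmem k)
    have h₂ := (le_abs_self _).trans
      (abs_dualPairingL2_le (y' - (hw k).toLp _) (x - (hφ k).toLp (φ k)))
    have h₃ := mul_le_mul_of_nonneg_right ((norm_sub_le y' ((hw k).toLp _)).trans
      (add_le_add_right (hR k) _)) (norm_nonneg (x - (hφ k).toLp (φ k)))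
    rw [← dualPairingL2CLM_apply] at h₁ h₂
    simp only [map_sub, sub_apply] at h₁ h₂ ⊢
    linarith
  have hzero : Tendsto (fun k => -((‖y'‖ + R) * ‖x - (hφ k).toLp (φ k)‖)) (hyperfilter ℕ)
      (𝓝 (-((‖y'‖ + R) * ‖x - x‖))) :=
    (((hlim.const_sub x).norm.const_mul _).neg).mono_left Nat.hyperfilter_le_atTop
  have := le_of_tendsto_of_tendsto' hzero ((hy (x' - x)).const_sub _) hlow
  rw [← dualPairingL2CLM_apply, map_sub (dualPairingL2CLM μ), sub_apply]
  simpa only [sub_self, norm_zero, mul_zero, neg_zero] using this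

end Lift

theorem mainTheorem12
    {E : Type*} [MeasurableSpace E] (μ : Measure E) [SigmaFinite μ] [μ.IsComplete]
    {S : Type*} [NormedAddCommGroup S] [InnerProductSpace ℝ S] [CompleteSpace S]
    [TopologicalSpace.SeparableSpace S]
    (A : E → S → Set (StrongDual ℝ S))
    (hA_nonempty : ∀ u x, (A u x).Nonempty)
    (hA_meas : ∀ x : S, IsMeasurableMultimap (fun u => A u x))
    (hA_maxmon : ∀ u : E, IsMaximalMonotone dualPairing (A u))
    (f : E → ℝ) (hf : MemLp f 2 μ) (hf_nonneg : 0 ≤ᵐ[μ] f)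
    (C : ℝ) (hC : 0 < C)
    (hA_growth : ∀ x : S, ∀ᵐ u ∂μ, ∀ y ∈ A u x, ‖y‖ ≤ f u + C * ‖x‖) :
    (∀ x : Lp S 2 μ, (nemytskiiLift μ A x).Nonempty) ∧
      IsMaximalMonotone dualPairingL2 (nemytskiiLift μ A) := by
  choose s hs hsA using
    exists_stronglyMeasurable_selection_apply hA_nonempty hA_meas hA_maxmon
  refine ⟨nemytskiiLift_nonempty hf hA_maxmon hA_growth hC.le hs hsA,
    isMonotoneMap_nemytskiiLift fun u => (hA_maxmon u).1, fun A' hA' hsub x => ?_⟩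
  refine Subset.antisymm (fun y hy => ?_) (hsub x)
  -- Every pair of a monotone extension is monotonically related to the original graph.
  exact mem_nemytskiiLift_of_forall hf hA_maxmon hA_growth hC.le hs hsA
    fun x' y' hy' => hA' (hsub x' hy') hy
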